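/- Let $n$ and $b$ be positive odd integers with $\gcd(n,b)=1$. For $s\in\mathbb{Z}/n\mathbb{Z}$ let $Z(s)=\{2^j s : j\ge 0\}$ be its $2$-cyclotomic coset, let $\mu_b(x)=bx$ on $\mathbb{Z}/n\mathbb{Z}$, and put $$\mathrm{Fix}_b(n)=\Big\{s\in\mathbb{Z}/n\mathbb{Z} : \tfrac{n}{\gcd(n,2^r-b)}\mid s\ \text{for some } 1\le r\le \mathrm{ord}_n(2)\Big\}.$$ A triple $(X,S_1,S_2)$ of non-empty, pairwise disjoint unions of $2$-cyclotomic cosets with $X\cup S_1\cup S_2=\mathbb{Z}/n\mathbb{Z}$ is a splitting given by $\mu_b$ if $\mu_b(S_1)=S_2$, $\mu_b(S_2)=S_1$, and $\mu_b(Z(s))=Z(s)$ for every $s\in X$. Let $\alpha$ be a primitive $n$-th root of unity in an extension field of $\mathbb{F}_2$. The defining set of a binary cyclic code of length $n$ with generator polynomial $g$ is $\{t\in\mathbb{Z}/n\mathbb{Z} : g(\alpha^t)=0\}$. **Theorem.** Suppose that $(\mathrm{Fix}_b(n),S_1,S_2)$ is a splitting of $\mathbb{Z}/n\mathbb{Z}$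 given by $\mu_b$, and let $C$ be the binary cyclic code of length $n$ with defining set $(\mathbb{Z}/n\mathbb{Z})\setminus \mathrm{Fix}_b(n)$, with minimum Hamming distance $d(C)$. Then there exists a binary quantum CSS code with parameters $[\![n,|\mathrm{Fix}_b(n)|,d]\!]_2$ with $d\ge\sqrt{d(C)}$. Here a quantum CSS code is the common $+1$ eigenspace $Q\subseteq\mathbb{C}^{2^n}$ of the group generated by the Pauli matrices $X^u$ ($u\in C_2$) and $Z^v$ ($v\in C_1^\perp$), for binary linear codes $C_2\subseteq C_1\subseteq\mathbb{F}_2^n$. It has parameters $[\![n,k,d]\!]_2$ (with $k\ge1$) if $\dim_{\mathbb{C}} Q=2^k$ and $d$ is the least weight of an $n$-qubit Pauli error $E$ that $Q$ does not detect, where $Q$ detects $E$ if there is a scalar $c$ with $\langle\psi,E\varphi\rangle=c\,\langle\psi,\varphi\rangle$ for all $\psi,\varphi\in Q$. -/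

import Mathlib

open scoped Matrix

noncomputable section

namespace QuantumDuadic

/-! ### Cyclotomic cosets, multipliers, splittings -/

/-- The 2-cyclotomic coset `Z(s) = {s, 2s, 4s, …}` modulo `n`. -/
def cyclotomicCoset (n : ℕ) (s : ZMod n) : Set (ZMod n) :=
  {t | ∃ j : ℕ, t = s * 2 ^ j}

/-- `A` is a union of 2-cyclotomic cosets modulo `n`. -/
def IsUnionOfCosets (n : ℕ) (A : Set (ZMod n)) : Prop :=
  ∃ T : Set (ZMod n), A = ⋃ s ∈ T, cyclotomicCoset n s

/-- The multiplier `μ_b(x) = b x` on `ℤ/nℤ`. -/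
def multiplier (n : ℕ) (b : ℤ) (x : ZMod n) : ZMod n := (b : ZMod n) * x

/-- `(X, S₁, S₂)` is a splitting of `ℤ/nℤ` that is given by `μ_b`. -/
structure IsSplitting (n : ℕ) (b : ℤ) (X S₁ S₂ : Set (ZMod n)) : Prop where
  coprime : Int.gcd (n : ℤ) b = 1
  cosets_X : IsUnionOfCosets n X
  cosets_S₁ : IsUnionOfCosets n S₁
  cosets_S₂ : IsUnionOfCosets n S₂
  cover : X ∪ S₁ ∪ S₂ = Set.univ
  nonempty_X : X.Nonempty
  nonempty_S₁ : S₁.Nonempty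
  nonempty_S₂ : S₂.Nonempty
  disjoint_X_S₁ : Disjoint X S₁
  disjoint_X_S₂ : Disjoint X S₂
  disjoint_S₁_S₂ : Disjoint S₁ S₂
  map_S₁ : multiplier n b '' S₁ = S₂
  map_S₂ : multiplier n b '' S₂ = S₁
  map_X : ∀ s ∈ X, multiplier n b '' cyclotomicCoset n s = cyclotomicCoset n s

/-- `Fix_b(n)`: the residues `s` with `n / gcd(n, 2^r - b) ∣ s` for some
`1 ≤ r ≤ ord_n(2)`. As `n / gcd(n, 2^r - b)` divides `n`, the divisibility does not depend on
the representative of `s`. -/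
def fixSet (n : ℕ) (b : ℤ) : Set (ZMod n) :=
  {s | ∃ r : ℕ, 1 ≤ r ∧ r ≤ orderOf (2 : ZMod n) ∧
    n / Int.gcd (n : ℤ) (2 ^ r - b) ∣ s.val}

/-! ### Binary linear and cyclic codes -/

/-- Binary linear codes of length `n`. -/
abbrev BinaryCode (n : ℕ) := Submodule (ZMod 2) (Fin n → ZMod 2)

/-- The Euclidean dual code. -/
def dualCode {n : ℕ} (C : BinaryCode n) : BinaryCode n where
  carrier := {u | ∀ c ∈ C, u ⬝ᵥ c = 0}
  zero_mem' := fun c _ => zero_dotProduct c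
  add_mem' := fun {u v} hu hv c hc => by
    rw [add_dotProduct, hu c hc, hv c hc, add_zero]
  smul_mem' := fun a u hu c hc => by
    rw [smul_dotProduct, hu c hc, smul_zero]

/-- The minimum Hamming distance of a (nonzero) linear code. -/
def minDist {n : ℕ} (C : BinaryCode n) : ℕ :=
  sInf {w | ∃ c ∈ C, c ≠ 0 ∧ hammingNorm c = w}

/-- `C` is closed under the shift `(c₀, …, c_{n-1}) ↦ (c_{n-1}, c₀, …, c_{n-2})`. -/
def IsCyclicCode {n : ℕ} (C : BinaryCode n) : Prop :=
  ∀ c ∈ C, (fun i => c ((finRotate n).symm i)) ∈ C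

/-- The polynomial `c₀ + c₁ x + ⋯ + c_{n-1} x^{n-1}` of a word. -/
def wordPoly {n : ℕ} (c : Fin n → ZMod 2) : Polynomial (ZMod 2) :=
  ∑ i : Fin n, Polynomial.C (c i) * Polynomial.X ^ (i : ℕ)

/-- `g` is the generator polynomial of `C`: the monic divisor of `x^n - 1` whose multiples (of
degree less than `n`) are the codewords. -/
structure IsGeneratorPolynomial {n : ℕ} (C : BinaryCode n) (g : Polynomial (ZMod 2)) : Prop where
  monic : g.Monic
  dvd : g ∣ Polynomial.X ^ n - 1
  mem_iff : ∀ c : Fin n → ZMod 2, c ∈ C ↔ g ∣ wordPoly c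

/-- `C` is the binary cyclic code of length `n` with defining set `A`, with respect to the
primitive `n`-th root of unity `α`: the exponents `t` for which `α^t` is a zero of the generator
polynomial of `C` are exactly the elements of `A`. -/
def HasDefiningSet {n : ℕ} {K : Type*} [Field K] [Algebra (ZMod 2) K] (α : K)
    (C : BinaryCode n) (A : Set (ZMod n)) : Prop :=
  IsCyclicCode C ∧ ∃ g : Polynomial (ZMod 2), IsGeneratorPolynomial C g ∧
    A = {t : ZMod n | Polynomial.aeval (α ^ t.val) g = 0}

/-! ### Qubits, Pauli matrices and CSS codes -/

/-- The space of `n` qubits, `ℂ^(2^n)`, with coordinates indexed by the computational basis. -/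
abbrev Qubits (n : ℕ) := (Fin n → Fin 2) → ℂ

/-- Complex `2^n × 2^n` matrices. -/
abbrev QubitMatrix (n : ℕ) := Matrix (Fin n → Fin 2) (Fin n → Fin 2) ℂ

/-- The Pauli matrix `X`. -/
def pauliX : Matrix (Fin 2) (Fin 2) ℂ := !![0, 1; 1, 0]

/-- The Pauli matrix `Z`. -/
def pauliZ : Matrix (Fin 2) (Fin 2) ℂ := !![1, 0; 0, -1]

/-- The `n`-qubit Pauli matrix `X^u Z^v`, the tensor (Kronecker) product of the matrices
`X^(u i) Z^(v i)`. -/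
def pauli {n : ℕ} (u v : Fin n → ZMod 2) : QubitMatrix n :=
  Matrix.of fun x y => ∏ i, (pauliX ^ (u i).val * pauliZ ^ (v i).val) (x i) (y i)

/-- The weight of `X^u Z^v`: the number of qubits on which it does not act as the identity. -/
def pauliWeight {n : ℕ} (u v : Fin n → ZMod 2) : ℕ :=
  (Finset.univ.filter fun i => u i ≠ 0 ∨ v i ≠ 0).card

/-- The group generated by the Pauli matrices `X^u`, `u ∈ C₂`, and `Z^v`, `v ∈ C₁^⊥`. -/
def cssStabilizer {n : ℕ} (C₁ C₂ : BinaryCode n) : Subgroup (QubitMatrix n)ˣ :=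
  Subgroup.closure
    ({M | ∃ u ∈ C₂, (M : QubitMatrix n) = pauli u 0} ∪
      {M | ∃ v ∈ dualCode C₁, (M : QubitMatrix n) = pauli 0 v})

/-- The common eigenspace with eigenvalue `+1` of a group of matrices. -/
def fixedSpace {n : ℕ} (G : Subgroup (QubitMatrix n)ˣ) : Submodule ℂ (Qubits n) where
  carrier := {ψ | ∀ M ∈ G, (M : QubitMatrix n) *ᵥ ψ = ψ}
  zero_mem' := fun _ _ => Matrix.mulVec_zero _
  add_mem' := fun {ψ φ} hψ hφ M hM => by
    rw [Matrix.mulVec_add, hψ M hM, hφ M hM]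
  smul_mem' := fun a ψ hψ M hM => by
    rw [Matrix.mulVec_smul, hψ M hM]

/-- `Q` is a CSS code: the common `+1` eigenspace of the stabilizer group of a pair of binary
linear codes `C₂ ⊆ C₁`. -/
def IsCSSCode {n : ℕ} (Q : Submodule ℂ (Qubits n)) : Prop :=
  ∃ C₁ C₂ : BinaryCode n, C₂ ≤ C₁ ∧ Q = fixedSpace (cssStabilizer C₁ C₂)

/-- The operator `E` is detectable by the code `Q` (Knill–Laflamme condition): there is a scalar
`c` with `⟨ψ, E φ⟩ = c ⟨ψ, φ⟩` for all `ψ, φ ∈ Q`; that is, `P E P = c P` for the orthogonal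
projection `P` onto `Q`. -/
def Detectable {n : ℕ} (Q : Submodule ℂ (Qubits n)) (E : QubitMatrix n) : Prop :=
  ∃ c : ℂ, ∀ ψ ∈ Q, ∀ φ ∈ Q, star ψ ⬝ᵥ (E *ᵥ φ) = c * (star ψ ⬝ᵥ φ)

/-- `Q` is an `[[n, k, d]]` binary quantum code (for `k ≥ 1`): it is a `2^k`-dimensional subspace
of the space of `n` qubits, and `d` is the least weight of a Pauli error that `Q` does not
detect. -/
structure IsQuantumCode {n : ℕ} (Q : Submodule ℂ (Qubits n)) (k d : ℕ) : Prop where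
  finrank_eq : Module.finrank ℂ Q = 2 ^ k
  isLeast : IsLeast {w | ∃ u v : Fin n → ZMod 2,
    ¬ Detectable Q (pauli u v) ∧ pauliWeight u v = w} d

end QuantumDuadic

end

namespace QuantumDuadic

/-! ### Duality of binary codes -/

/-! Write `X` for `Fix_b(n)`. Take `C₁` to be the words whose Fourier transform vanishes on `S₁`,
and `C₂` those for which it vanishes on `S₁ ∪ X`. By `dualCode_spectralCode` their dimensions differ
by `|X|`, and the duals of `C₁`, `C₂` are the words with zeros on `-(S₂ ∪ X)` and `-S₂`. The CSS
space is the space of functions on `C₁ / C₂`, which gives its dimension, and an undetected Pauli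
error has a component in `C₁ \ C₂` or in `C₂^⊥ \ C₁^⊥`.

It remains to bound the weights of such words. Let `c ∈ C₁ \ C₂`, with transform `ĉ`. The product
`ĉ(t) ĉ(bt)` is the transform of a word `w` of weight at most `wt(c)²` (`exists_dft_eq_mul`). It
vanishes on `S₁` by the first factor and on `S₂` by the second, as `b S₂ = S₁`, so `w ∈ C`. Some `s
∈ X` has `ĉ(s) ≠ 0`; there `bs = 2^j s`, and by Frobenius the second factor is a power of the first,
so `w ≠ 0`. Hence `d(C) ≤ wt(c)²` (`minDist_le_hammingNorm_sq`). The dual side is the same after `t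
↦ -t` and exchanging `S₁` with `S₂`. -/

theorem mem_dualCode {n : ℕ} {C : BinaryCode n} {u : Fin n → ZMod 2} :
    u ∈ dualCode C ↔ ∀ c ∈ C, u ⬝ᵥ c = 0 := Iff.rfl

theorem dotProductBilin_nondegenerate (n : ℕ) :
    LinearMap.BilinForm.Nondegenerate
      (dotProductBilin (ZMod 2) (ZMod 2) : LinearMap.BilinForm (ZMod 2) (Fin n → ZMod 2)) := by
  constructor
  · intro u hu
    exact dotProduct_eq_zero u fun w => hu w
  · intro u hu
    exact dotProduct_eq_zero u fun w => by rw [dotProduct_comm]; exact hu w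

theorem dualCode_eq_orthogonal {n : ℕ} (C : BinaryCode n) :
    dualCode C = LinearMap.BilinForm.orthogonal
      (dotProductBilin (ZMod 2) (ZMod 2) : LinearMap.BilinForm (ZMod 2) (Fin n → ZMod 2)) C := by
  ext u
  rw [mem_dualCode, LinearMap.BilinForm.mem_orthogonal_iff]
  refine forall₂_congr fun c _ => ?_
  rw [dotProduct_comm]
  rfl

theorem finrank_dualCode {n : ℕ} (C : BinaryCode n) :
    Module.finrank (ZMod 2) (dualCode C) = n - Module.finrank (ZMod 2) C := by
  rw [dualCode_eq_orthogonal, LinearMap.BilinForm.finrank_orthogonal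
    (dotProductBilin_nondegenerate n), Module.finrank_fin_fun]

theorem dualCode_dualCode {n : ℕ} (C : BinaryCode n) : dualCode (dualCode C) = C := by
  rw [dualCode_eq_orthogonal, dualCode_eq_orthogonal]
  refine LinearMap.BilinForm.orthogonal_orthogonal (dotProductBilin_nondegenerate n) ?_ C
  intro u v h
  change v ⬝ᵥ u = 0
  rw [dotProduct_comm]
  exact h

theorem zmodTwo_eq_one {a : ZMod 2} (h : a ≠ 0) : a = 1 := by
  revert a; decide

/-! ### The action of Pauli matrices -/

/-- The character `a ↦ (-1)^a` of `ZMod 2`. -/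
noncomputable def sign (a : ZMod 2) : ℂ := if a = 0 then 1 else -1

@[simp] theorem sign_zero : sign 0 = 1 := if_pos rfl

@[simp] theorem sign_one : sign 1 = -1 := if_neg one_ne_zero

theorem sign_add (a b : ZMod 2) : sign (a + b) = sign a * sign b := by
  have h : ∀ a : ZMod 2, a = 0 ∨ a = 1 := by decide
  have h2 : (1 : ZMod 2) + 1 = 0 := by decide
  rcases h a with rfl | rfl <;> rcases h b with rfl | rfl <;> simp [h2]

theorem sign_sum {ι : Type*} (s : Finset ι) (f : ι → ZMod 2) :
    sign (∑ i ∈ s, f i) = ∏ i ∈ s, sign (f i) := by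
  classical
  induction s using Finset.induction_on with
  | empty => simp
  | insert a s ha ih => rw [Finset.sum_insert ha, Finset.prod_insert ha, sign_add, ih]

/-- The identification of `ZMod 2` with the index set of the basis of a qubit. -/
def bit : ZMod 2 ≃ Fin 2 := Equiv.refl (Fin 2)

/-- The identification of binary words with the computational basis of `n` qubits. -/
def bits {n : ℕ} : (Fin n → ZMod 2) ≃ (Fin n → Fin 2) := Equiv.piCongrRight fun _ => bit

theorem bit_zero : bit 0 = 0 := rfl

theorem bit_one : bit 1 = 1 := rfl

theorem bits_apply {n : ℕ} (x : Fin n → ZMod 2) (i : Fin n) : bits x i = bit (x i) := rfl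

theorem qubits_ext {n : ℕ} {ψ φ : Qubits n} (h : ∀ x, ψ (bits x) = φ (bits x)) : ψ = φ :=
  funext fun y => by simpa using h (bits.symm y)

theorem star_dotProduct_qubits {n : ℕ} (ψ φ : Qubits n) :
    star ψ ⬝ᵥ φ = ∑ x : Fin n → ZMod 2, star (ψ (bits x)) * φ (bits x) :=
  (Equiv.sum_comp bits fun y => star (ψ y) * φ y).symm

theorem pauliX_pow_mul_pauliZ_pow_apply (a b x y : ZMod 2) :
    (pauliX ^ a.val * pauliZ ^ b.val) (bit x) (bit y) = if y = x + a then sign (b * y) else 0 := by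
  have h : ∀ a : ZMod 2, a = 0 ∨ a = 1 := by decide
  have h2 : (1 : ZMod 2) + 1 = 0 := by decide
  have v1 : (1 : ZMod 2).val = 1 := rfl
  have v0 : (0 : ZMod 2).val = 0 := rfl
  rcases h a with rfl | rfl <;> rcases h b with rfl | rfl <;> rcases h x with rfl | rfl <;>
    rcases h y with rfl | rfl <;>
    simp [v0, v1, pauliX, pauliZ, h2, bit_zero, bit_one, Matrix.mul_apply, Fin.sum_univ_two]

/-- Row `x` of `X^u Z^v` has its only nonzero entry in column `x + u`. This formula replaces the
Kronecker product from here on. -/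
theorem pauli_mulVec_apply {n : ℕ} (u v : Fin n → ZMod 2) (ψ : Qubits n) (x : Fin n → ZMod 2) :
    (pauli u v *ᵥ ψ) (bits x) = sign (v ⬝ᵥ (x + u)) * ψ (bits (x + u)) := by
  have h : ∀ y : Fin n → ZMod 2,
      pauli u v (bits x) (bits y) = if y = x + u then sign (v ⬝ᵥ y) else 0 := by
    intro y
    rw [pauli, Matrix.of_apply]
    simp only [bits_apply, pauliX_pow_mul_pauliZ_pow_apply]
    split_ifs with hy
    · subst hy
      simp [dotProduct, sign_sum]
    · obtain ⟨i, hi⟩ : ∃ i, y i ≠ x i + u i := by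
        by_contra! hc
        exact hy (funext hc)
      exact Finset.prod_eq_zero (Finset.mem_univ i) (if_neg hi)
  rw [Matrix.mulVec, dotProduct, ← Equiv.sum_comp bits]
  simp only [h, ite_mul, zero_mul, Finset.sum_ite_eq', Finset.mem_univ, if_true]

theorem add_self_word {n : ℕ} (u : Fin n → ZMod 2) : u + u = 0 :=
  funext fun i => CharTwo.add_self_eq_zero (u i)

theorem exists_unit_eq_pauli_left {n : ℕ} (u : Fin n → ZMod 2) :
    ∃ M : (QubitMatrix n)ˣ, (M : QubitMatrix n) = pauli u 0 := by
  have h : pauli u 0 * pauli u 0 = (1 : QubitMatrix n) := by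
    refine Matrix.ext_iff_mulVec.2 fun ψ => qubits_ext fun x => ?_
    rw [← Matrix.mulVec_mulVec, Matrix.one_mulVec, pauli_mulVec_apply, pauli_mulVec_apply,
      add_assoc, add_self_word]
    simp
  exact ⟨⟨pauli u 0, pauli u 0, h, h⟩, rfl⟩

theorem exists_unit_eq_pauli_right {n : ℕ} (v : Fin n → ZMod 2) :
    ∃ M : (QubitMatrix n)ˣ, (M : QubitMatrix n) = pauli 0 v := by
  have h : pauli 0 v * pauli 0 v = (1 : QubitMatrix n) := by
    refine Matrix.ext_iff_mulVec.2 fun ψ => qubits_ext fun x => ?_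
    rw [← Matrix.mulVec_mulVec, Matrix.one_mulVec, pauli_mulVec_apply, pauli_mulVec_apply,
      ← mul_assoc, ← sign_add]
    simp [CharTwo.add_self_eq_zero]
  exact ⟨⟨pauli 0 v, pauli 0 v, h, h⟩, rfl⟩

/-! ### CSS codes -/

theorem mem_fixedSpace_closure {n : ℕ} {T : Set (QubitMatrix n)ˣ} {ψ : Qubits n} :
    ψ ∈ fixedSpace (Subgroup.closure T) ↔ ∀ M ∈ T, (M : QubitMatrix n) *ᵥ ψ = ψ := by
  refine ⟨fun h M hM => h M (Subgroup.subset_closure hM), fun h M hM => ?_⟩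
  induction hM using Subgroup.closure_induction with
  | mem M hM => exact h M hM
  | one => exact Matrix.one_mulVec ψ
  | mul M N _ _ hM hN => rw [Units.val_mul, ← Matrix.mulVec_mulVec, hN, hM]
  | inv M _ hM =>
    conv_lhs => rw [← hM]
    rw [Matrix.mulVec_mulVec, ← Units.val_mul, inv_mul_cancel, Units.val_one, Matrix.one_mulVec]

/-- `X^u` translates by `u`, and `Z^v` multiplies by `(-1)^(v·x)`. So the `Z` part forces `ψ` to
vanish at every `x` not orthogonal to `C₁^⊥`, which by biduality means off `C₁`. -/
theorem mem_cssSpace_iff {n : ℕ} {C₁ C₂ : BinaryCode n} {ψ : Qubits n} :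
    ψ ∈ fixedSpace (cssStabilizer C₁ C₂) ↔
      (∀ u ∈ C₂, ∀ x, ψ (bits (x + u)) = ψ (bits x)) ∧ ∀ x, x ∉ C₁ → ψ (bits x) = 0 := by
  rw [cssStabilizer, mem_fixedSpace_closure]
  constructor
  · refine fun h => ⟨fun u hu x => ?_, fun x hx => ?_⟩
    · obtain ⟨M, hM⟩ := exists_unit_eq_pauli_left u
      have := congrFun (h M (Or.inl ⟨u, hu, hM⟩)) (bits x)
      rw [hM, pauli_mulVec_apply] at this
      simpa using this
    · rw [← dualCode_dualCode C₁, mem_dualCode] at hx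
      push Not at hx
      obtain ⟨v, hv, hvx⟩ := hx
      obtain ⟨M, hM⟩ := exists_unit_eq_pauli_right v
      have := congrFun (h M (Or.inr ⟨v, hv, hM⟩)) (bits x)
      rw [hM, pauli_mulVec_apply, add_zero, dotProduct_comm, zmodTwo_eq_one hvx, sign_one] at this
      linear_combination (-1 / 2 : ℂ) * this
  · rintro ⟨h1, h2⟩ M (⟨u, hu, hM⟩ | ⟨v, hv, hM⟩)
    · rw [hM]
      refine qubits_ext fun x => ?_
      rw [pauli_mulVec_apply]
      simpa using h1 u hu x
    · rw [hM]
      refine qubits_ext fun x => ?_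
      rw [pauli_mulVec_apply, add_zero]
      by_cases hx : x ∈ C₁
      · rw [hv x hx, sign_zero, one_mul]
      · rw [h2 x hx, mul_zero]

open Classical in
/-- A function on `C₁ / C₂`, pulled back to `C₁` and extended by zero. -/
noncomputable def cssLift {n : ℕ} (C₁ C₂ : BinaryCode n) :
    ((C₁ ⧸ C₂.submoduleOf C₁) → ℂ) →ₗ[ℂ] Qubits n where
  toFun f y := if h : bits.symm y ∈ C₁ then f (Submodule.Quotient.mk ⟨bits.symm y, h⟩) else 0
  map_add' f g := by
    funext y
    by_cases h : bits.symm y ∈ C₁ <;> simp [h]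
  map_smul' a f := by
    funext y
    by_cases h : bits.symm y ∈ C₁ <;> simp [h]

theorem cssLift_apply_mem {n : ℕ} {C₁ C₂ : BinaryCode n} (f : (C₁ ⧸ C₂.submoduleOf C₁) → ℂ)
    (x : C₁) : cssLift C₁ C₂ f (bits x) = f (Submodule.Quotient.mk x) := by
  simp [cssLift]

theorem cssLift_apply_notMem {n : ℕ} {C₁ C₂ : BinaryCode n} (f : (C₁ ⧸ C₂.submoduleOf C₁) → ℂ)
    {x : Fin n → ZMod 2} (hx : x ∉ C₁) : cssLift C₁ C₂ f (bits x) = 0 := by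
  simp [cssLift, hx]

theorem cssLift_injective {n : ℕ} (C₁ C₂ : BinaryCode n) :
    Function.Injective (cssLift C₁ C₂) := by
  intro f g h
  funext q
  obtain ⟨x, rfl⟩ := Submodule.Quotient.mk_surjective _ q
  rw [← cssLift_apply_mem f, ← cssLift_apply_mem g, h]

theorem mk_submoduleOf_eq_iff {n : ℕ} {C₁ C₂ : BinaryCode n} {x y : C₁} :
    (Submodule.Quotient.mk x : C₁ ⧸ C₂.submoduleOf C₁) = Submodule.Quotient.mk y ↔
      (x - y : Fin n → ZMod 2) ∈ C₂ := by
  rw [Submodule.Quotient.eq]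
  rfl

theorem range_cssLift {n : ℕ} {C₁ C₂ : BinaryCode n} (hC : C₂ ≤ C₁) :
    LinearMap.range (cssLift C₁ C₂) = fixedSpace (cssStabilizer C₁ C₂) := by
  apply le_antisymm
  · rintro _ ⟨f, rfl⟩
    refine mem_cssSpace_iff.2 ⟨fun u hu x => ?_, fun x hx => cssLift_apply_notMem f hx⟩
    by_cases hx : x ∈ C₁
    · rw [cssLift_apply_mem f ⟨x + u, C₁.add_mem hx (hC hu)⟩, cssLift_apply_mem f ⟨x, hx⟩]
      congr 1
      rw [mk_submoduleOf_eq_iff]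
      simpa using hu
    · have hxu : x + u ∉ C₁ := fun h => hx (by simpa using C₁.sub_mem h (hC hu))
      rw [cssLift_apply_notMem f hx, cssLift_apply_notMem f hxu]
  · intro ψ hψ
    obtain ⟨h1, h2⟩ := mem_cssSpace_iff.1 hψ
    -- The chosen coset representative is harmless, since `ψ` is invariant under `C₂`.
    refine ⟨fun q => ψ (bits (Quotient.out q : C₁)), qubits_ext fun x => ?_⟩
    by_cases hx : x ∈ C₁
    · rw [cssLift_apply_mem _ ⟨x, hx⟩]
      have h3 := mk_submoduleOf_eq_iff.1
        (Quotient.out_eq (Submodule.Quotient.mk ⟨x, hx⟩ : C₁ ⧸ C₂.submoduleOf C₁))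
      simpa using h1 _ h3 x
    · rw [cssLift_apply_notMem _ hx, h2 x hx]

theorem finrank_cssSpace {n : ℕ} {C₁ C₂ : BinaryCode n} (hC : C₂ ≤ C₁) :
    Module.finrank ℂ (fixedSpace (cssStabilizer C₁ C₂)) =
      2 ^ (Module.finrank (ZMod 2) C₁ - Module.finrank (ZMod 2) C₂) := by
  classical
  rw [← range_cssLift hC, LinearMap.finrank_range_of_inj (cssLift_injective C₁ C₂)]
  have : Fintype (C₁ ⧸ C₂.submoduleOf C₁) := Fintype.ofFinite _
  rw [Module.finrank_fintype_fun_eq_card, Module.card_eq_pow_finrank (K := ZMod 2), ZMod.card]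
  congr 1
  have h1 := Submodule.finrank_quotient_add_finrank (C₂.submoduleOf C₁)
  rw [(Submodule.submoduleOfEquivOfLe hC).finrank_eq] at h1
  lia

theorem detectable_of_stabilizer {n : ℕ} {C₁ C₂ : BinaryCode n} {u v : Fin n → ZMod 2}
    (hu : u ∈ C₂) (hv : v ∈ dualCode C₁) :
    Detectable (fixedSpace (cssStabilizer C₁ C₂)) (pauli u v) := by
  refine ⟨1, fun ψ _ φ hφ => ?_⟩
  obtain ⟨h1, h2⟩ := mem_cssSpace_iff.1 hφ
  rw [one_mul]
  congr 1
  refine qubits_ext fun x => ?_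
  rw [pauli_mulVec_apply]
  by_cases hx : x + u ∈ C₁
  · rw [hv _ hx, sign_zero, one_mul, h1 u hu x]
  · rw [h2 _ hx, ← h1 u hu x, h2 _ hx, mul_zero]

/-- States of the code are supported on `C₁`, and the error moves the support to the disjoint coset
`C₁ + u`. -/
theorem detectable_of_left_notMem {n : ℕ} {C₁ C₂ : BinaryCode n} {u : Fin n → ZMod 2}
    (hu : u ∉ C₁) (v : Fin n → ZMod 2) :
    Detectable (fixedSpace (cssStabilizer C₁ C₂)) (pauli u v) := by
  refine ⟨0, fun ψ hψ φ hφ => ?_⟩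
  have h1 := (mem_cssSpace_iff.1 hψ).2
  have h2 := (mem_cssSpace_iff.1 hφ).2
  rw [zero_mul]
  rw [star_dotProduct_qubits]
  refine Finset.sum_eq_zero fun x _ => ?_
  rw [pauli_mulVec_apply]
  by_cases hx : x ∈ C₁
  · have hxu : x + u ∉ C₁ := fun h => hu (by simpa using C₁.sub_mem h hx)
    rw [h2 _ hxu, mul_zero, mul_zero]
  · rw [h1 x hx, star_zero, zero_mul]

/-- For `c ∈ C₂` with `v·c = 1`, the stabilizer `X^c` anticommutes with the error. Translating the
sum by `c` therefore changes its sign, and the sum is zero. -/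
theorem detectable_of_right_notMem {n : ℕ} {C₁ C₂ : BinaryCode n} (u : Fin n → ZMod 2)
    {v : Fin n → ZMod 2} (hv : v ∉ dualCode C₂) :
    Detectable (fixedSpace (cssStabilizer C₁ C₂)) (pauli u v) := by
  rw [mem_dualCode] at hv
  push Not at hv
  obtain ⟨c, hc, hvc⟩ := hv
  refine ⟨0, fun ψ hψ φ hφ => ?_⟩
  have h1 := (mem_cssSpace_iff.1 hψ).1 c hc
  have h2 := (mem_cssSpace_iff.1 hφ).1 c hc
  rw [zero_mul]
  rw [star_dotProduct_qubits]
  simp only [pauli_mulVec_apply]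
  have h4 : ∑ x : Fin n → ZMod 2, star (ψ (bits x)) * (sign (v ⬝ᵥ (x + u)) * φ (bits (x + u))) =
      -∑ x : Fin n → ZMod 2, star (ψ (bits x)) * (sign (v ⬝ᵥ (x + u)) * φ (bits (x + u))) := by
    conv_lhs => rw [← Equiv.sum_comp (Equiv.addRight c)]
    rw [← Finset.sum_neg_distrib]
    refine Finset.sum_congr rfl fun x _ => ?_
    rw [Equiv.coe_addRight, h1, add_right_comm, h2, dotProduct_add _ (x + u), sign_add,
      zmodTwo_eq_one hvc, sign_one]
    ring
  linear_combination (1 / 2 : ℂ) * h4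

/-- The indicators of `C₂` and of `C₂ + u` are orthogonal code states, and `X^u` carries the second
to the first. -/
theorem not_detectable_pauli_left {n : ℕ} {C₁ C₂ : BinaryCode n} (hC : C₂ ≤ C₁)
    {u : Fin n → ZMod 2} (hu₁ : u ∈ C₁) (hu₂ : u ∉ C₂) :
    ¬ Detectable (fixedSpace (cssStabilizer C₁ C₂)) (pauli u 0) := by
  classical
  rintro ⟨c, hc⟩
  let ψ : Qubits n := fun y => if bits.symm y ∈ C₂ then 1 else 0
  let φ : Qubits n := fun y => if bits.symm y + u ∈ C₂ then 1 else 0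
  have hψ' : ∀ x, ψ (bits x) = if x ∈ C₂ then 1 else 0 := fun x => by simp [ψ]
  have hφ' : ∀ x, φ (bits x) = if x + u ∈ C₂ then 1 else 0 := fun x => by simp [φ]
  have hadd : ∀ y ∈ C₂, ∀ x, x + y ∈ C₂ ↔ x ∈ C₂ := fun y hy x => C₂.add_mem_iff_left hy
  have hψ : ψ ∈ fixedSpace (cssStabilizer C₁ C₂) := by
    refine mem_cssSpace_iff.2 ⟨fun y hy x => ?_, fun x hx => ?_⟩
    · simp only [hψ', hadd y hy]
    · rw [hψ', if_neg fun h => hx (hC h)]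
  have hφ : φ ∈ fixedSpace (cssStabilizer C₁ C₂) := by
    refine mem_cssSpace_iff.2 ⟨fun y hy x => ?_, fun x hx => ?_⟩
    · simp only [hφ', add_right_comm x y u, hadd y hy]
    · rw [hφ', if_neg fun h => hx (by simpa using C₁.sub_mem (hC h) hu₁)]
  have h := hc ψ hψ φ hφ
  have h0 : star ψ ⬝ᵥ φ = 0 := by
    rw [star_dotProduct_qubits]
    refine Finset.sum_eq_zero fun x _ => ?_
    by_cases hx : x ∈ C₂
    · have : x + u ∉ C₂ := fun h => hu₂ (by simpa using C₂.sub_mem h hx)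
      rw [hφ', if_neg this, mul_zero]
    · rw [hψ', if_neg hx, star_zero, zero_mul]
  have h1 : star ψ ⬝ᵥ (pauli u 0 *ᵥ φ) =
      ∑ x : Fin n → ZMod 2, if x ∈ C₂ then 1 else 0 := by
    rw [star_dotProduct_qubits]
    refine Finset.sum_congr rfl fun x _ => ?_
    rw [pauli_mulVec_apply, zero_dotProduct, sign_zero, one_mul, hψ', hφ', add_assoc,
      add_self_word, add_zero]
    split_ifs <;> simp
  rw [h0, mul_zero, h1, Finset.sum_boole, Nat.cast_eq_zero, Finset.card_eq_zero,
    Finset.filter_eq_empty_iff] at h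
  exact h (Finset.mem_univ 0) C₂.zero_mem

theorem hammingNorm_left_le_pauliWeight {n : ℕ} (u v : Fin n → ZMod 2) :
    hammingNorm u ≤ pauliWeight u v :=
  Finset.card_le_card fun i hi => by
    simp only [Finset.mem_filter, Finset.mem_univ, true_and] at hi ⊢
    exact Or.inl hi

theorem hammingNorm_right_le_pauliWeight {n : ℕ} (u v : Fin n → ZMod 2) :
    hammingNorm v ≤ pauliWeight u v :=
  Finset.card_le_card fun i hi => by
    simp only [Finset.mem_filter, Finset.mem_univ, true_and] at hi ⊢
    exact Or.inr hi

/-- The CSS code of `C₂ < C₁` is a quantum code whose distance is at least any common lower bound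
of the weights of the words of `C₁ \ C₂` and of `C₂^⊥ \ C₁^⊥`. -/
theorem exists_isQuantumCode_cssSpace {n : ℕ} {C₁ C₂ : BinaryCode n} (hC : C₂ < C₁) {D : ℕ → Prop}
    (hD : Monotone D) (h₁ : ∀ u ∈ C₁, u ∉ C₂ → D (hammingNorm u))
    (h₂ : ∀ v ∈ dualCode C₂, v ∉ dualCode C₁ → D (hammingNorm v)) :
    ∃ d, IsQuantumCode (fixedSpace (cssStabilizer C₁ C₂))
      (Module.finrank (ZMod 2) C₁ - Module.finrank (ZMod 2) C₂) d ∧ D d := by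
  obtain ⟨u, hu₁, hu₂⟩ := SetLike.exists_of_lt hC
  set W : Set ℕ := {w | ∃ u v : Fin n → ZMod 2,
    ¬ Detectable (fixedSpace (cssStabilizer C₁ C₂)) (pauli u v) ∧ pauliWeight u v = w}
  -- Nonemptiness is needed for `sInf W` to be attained, as `sInf ∅ = 0`.
  have hW : W.Nonempty := ⟨_, u, 0, not_detectable_pauli_left hC.le hu₁ hu₂, rfl⟩
  refine ⟨sInf W, ⟨finrank_cssSpace hC.le, Nat.sInf_mem hW, fun w hw => Nat.sInf_le hw⟩, ?_⟩
  obtain ⟨u, v, huv, hw⟩ := Nat.sInf_mem hW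
  rw [← hw]
  by_cases hu : u ∈ C₂
  · have hv₁ : v ∉ dualCode C₁ := fun hv => huv (detectable_of_stabilizer hu hv)
    have hv₂ : v ∈ dualCode C₂ := by
      by_contra hv
      exact huv (detectable_of_right_notMem u hv)
    exact hD (hammingNorm_right_le_pauliWeight u v) (h₂ v hv₂ hv₁)
  · have hu₁ : u ∈ C₁ := by
      by_contra hu'
      exact huv (detectable_of_left_notMem hu' v)
    exact hD (hammingNorm_left_le_pauliWeight u v) (h₁ u hu₁ hu)


/-! ### Cyclotomic cosets and splittings -/

theorem IsUnionOfCosets.two_mul_mem {n : ℕ} {A : Set (ZMod n)} (hA : IsUnionOfCosets n A)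
    {t : ZMod n} (ht : t ∈ A) : 2 * t ∈ A := by
  obtain ⟨T, rfl⟩ := hA
  obtain ⟨s, hs, j, rfl⟩ := Set.mem_iUnion₂.1 ht
  exact Set.mem_iUnion₂.2 ⟨s, hs, j + 1, by ring⟩

theorem IsSplitting.symm {n : ℕ} {b : ℤ} {X S₁ S₂ : Set (ZMod n)}
    (h : IsSplitting n b X S₁ S₂) : IsSplitting n b X S₂ S₁ where
  coprime := h.coprime
  cosets_X := h.cosets_X
  cosets_S₁ := h.cosets_S₂
  cosets_S₂ := h.cosets_S₁
  cover := by rw [Set.union_right_comm, h.cover]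
  nonempty_X := h.nonempty_X
  nonempty_S₁ := h.nonempty_S₂
  nonempty_S₂ := h.nonempty_S₁
  disjoint_X_S₁ := h.disjoint_X_S₂
  disjoint_X_S₂ := h.disjoint_X_S₁
  disjoint_S₁_S₂ := h.disjoint_S₁_S₂.symm
  map_S₁ := h.map_S₂
  map_S₂ := h.map_S₁
  map_X := h.map_X

theorem IsSplitting.mem_cases {n : ℕ} {b : ℤ} {X S₁ S₂ : Set (ZMod n)}
    (h : IsSplitting n b X S₁ S₂) (t : ZMod n) : t ∈ X ∨ t ∈ S₁ ∨ t ∈ S₂ := by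
  have ht : t ∈ X ∪ S₁ ∪ S₂ := h.cover ▸ Set.mem_univ t
  rwa [Set.mem_union, Set.mem_union, or_assoc] at ht

theorem IsSplitting.compl_S₁ {n : ℕ} {b : ℤ} {X S₁ S₂ : Set (ZMod n)}
    (h : IsSplitting n b X S₁ S₂) : S₁ᶜ = S₂ ∪ X := by
  ext t
  have h1 : t ∈ X → t ∉ S₁ := fun ht => Set.disjoint_left.1 h.disjoint_X_S₁ ht
  have h2 : t ∈ S₁ → t ∉ S₂ := fun ht => Set.disjoint_left.1 h.disjoint_S₁_S₂ ht
  have h3 := h.mem_cases t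
  simp only [Set.mem_compl_iff, Set.mem_union]
  tauto

theorem IsSplitting.mul_mem_of_mem {n : ℕ} {b : ℤ} {X S₁ S₂ : Set (ZMod n)}
    (h : IsSplitting n b X S₁ S₂) {t : ZMod n} (ht : t ∈ S₁) : (b : ZMod n) * t ∈ S₂ :=
  h.map_S₁ ▸ Set.mem_image_of_mem (multiplier n b) ht

/-- On `X` the multiplier acts pointwise as a power of two, which links it to Frobenius. -/
theorem IsSplitting.exists_mul_eq {n : ℕ} {b : ℤ} {X S₁ S₂ : Set (ZMod n)}
    (h : IsSplitting n b X S₁ S₂) {s : ZMod n} (hs : s ∈ X) :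
    ∃ j : ℕ, (b : ZMod n) * s = 2 ^ j * s := by
  have h1 : multiplier n b s ∈ cyclotomicCoset n s :=
    h.map_X s hs ▸ Set.mem_image_of_mem _ ⟨0, by simp⟩
  obtain ⟨j, hj⟩ := h1
  exact ⟨j, by rw [mul_comm (2 ^ j), ← hj, multiplier]⟩

/-! ### The discrete Fourier transform of a binary word -/

section Fourier

variable {n : ℕ} {K : Type*} [Field K] [Algebra (ZMod 2) K]

/-- The discrete Fourier transform `t ↦ ∑ i, c i χ(i t)` of a binary word. -/
def dft (χ : AddChar (ZMod n) K) : (Fin n → ZMod 2) →ₗ[ZMod 2] (ZMod n → K) where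
  toFun c t := ∑ i : Fin n, algebraMap (ZMod 2) K (c i) * χ ((i : ℕ) * t)
  map_add' c d := by
    funext t
    simp [add_mul, Finset.sum_add_distrib]
  map_smul' a c := by
    funext t
    simp [mul_assoc, Finset.mul_sum, Algebra.smul_def]

theorem dft_apply (χ : AddChar (ZMod n) K) (c : Fin n → ZMod 2) (t : ZMod n) :
    dft χ c t = ∑ i : Fin n, algebraMap (ZMod 2) K (c i) * χ ((i : ℕ) * t) := rfl

/-- The words whose Fourier transform vanishes on `A`. -/
def spectralCode (χ : AddChar (ZMod n) K) (A : Set (ZMod n)) : BinaryCode n where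
  carrier := {c | ∀ t ∈ A, dft χ c t = 0}
  zero_mem' t _ := by rw [map_zero, Pi.zero_apply]
  add_mem' {c d} hc hd t ht := by rw [map_add, Pi.add_apply, hc t ht, hd t ht, add_zero]
  smul_mem' a c hc t ht := by rw [map_smul, Pi.smul_apply, hc t ht, smul_zero]

theorem mem_spectralCode {χ : AddChar (ZMod n) K} {A : Set (ZMod n)} {c : Fin n → ZMod 2} :
    c ∈ spectralCode χ A ↔ ∀ t ∈ A, dft χ c t = 0 := Iff.rfl

theorem charP_two_of_algebra (K : Type*) [Field K] [Algebra (ZMod 2) K] : CharP K 2 :=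
  charP_of_injective_algebraMap (algebraMap (ZMod 2) K).injective 2

/-- Squaring is additive in characteristic 2 and fixes the coefficients of `c`. -/
theorem dft_two_mul (χ : AddChar (ZMod n) K) (c : Fin n → ZMod 2) (t : ZMod n) :
    dft χ c (2 * t) = dft χ c t ^ 2 := by
  have := charP_two_of_algebra K
  have h : ∀ a : ZMod 2, a ^ 2 = a := by decide
  rw [dft_apply, dft_apply, sum_pow_char]
  refine Finset.sum_congr rfl fun i _ => ?_
  rw [mul_pow, ← map_pow, h, ← AddChar.map_nsmul_eq_pow]
  congr 2
  simp
  ring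

theorem dft_two_pow_mul_ne_zero {χ : AddChar (ZMod n) K} {c : Fin n → ZMod 2} {t : ZMod n}
    (ht : dft χ c t ≠ 0) (j : ℕ) : dft χ c (2 ^ j * t) ≠ 0 := by
  induction j with
  | zero => simpa using ht
  | succ j ih =>
    rw [pow_succ', mul_assoc, dft_two_mul]
    exact pow_ne_zero 2 ih

theorem dft_single [NeZero n] (χ : AddChar (ZMod n) K) (k : ZMod n) (a : ZMod 2) (t : ZMod n) :
    dft χ (Pi.single ⟨k.val, ZMod.val_lt k⟩ a) t = algebraMap (ZMod 2) K a * χ (k * t) := by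
  rw [dft_apply, Finset.sum_eq_single (⟨k.val, ZMod.val_lt k⟩ : Fin n)]
  · simp
  · intro i _ hi
    simp [Pi.single_eq_of_ne hi]
  · simp

/-- The product of two dilates of a Fourier transform is the Fourier transform of a word of at
most the square of the weight. -/
theorem exists_dft_eq_mul [NeZero n] (χ : AddChar (ZMod n) K) (c : Fin n → ZMod 2)
    (p q : ZMod n) :
    ∃ w : Fin n → ZMod 2, (∀ t, dft χ w t = dft χ c (p * t) * dft χ c (q * t)) ∧
      hammingNorm w ≤ hammingNorm c ^ 2 := by
  let idx : Fin n × Fin n → Fin n := fun x =>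
    ⟨(p * (x.1 : ℕ) + q * (x.2 : ℕ) : ZMod n).val, ZMod.val_lt _⟩
  -- This is `c(x^p) c(x^q)` modulo `x^n - 1`, expanded with one term per pair of positions; the
  -- support lies in the image of the pairs from the support of `c`.
  refine ⟨∑ x : Fin n × Fin n, Pi.single (idx x) (c x.1 * c x.2), fun t => ?_, ?_⟩
  · rw [map_sum, Finset.sum_apply, dft_apply, dft_apply, Finset.sum_mul_sum,
      ← Finset.univ_product_univ, Finset.sum_product]
    refine Finset.sum_congr rfl fun i _ => Finset.sum_congr rfl fun j _ => ?_
    rw [dft_single, map_mul, mul_mul_mul_comm, ← AddChar.map_add_eq_mul]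
    congr 2
    ring
  · set S : Finset (Fin n) := Finset.univ.filter fun i => c i ≠ 0 with hS
    have hsub : (Finset.univ.filter fun k =>
        (∑ x : Fin n × Fin n, Pi.single (idx x) (c x.1 * c x.2) : Fin n → ZMod 2) k ≠ 0) ⊆
        (S ×ˢ S).image idx := by
      intro k hk
      rw [Finset.mem_filter, Finset.sum_apply] at hk
      obtain ⟨x, -, hx⟩ := Finset.exists_ne_zero_of_sum_ne_zero hk.2
      have hk : k = idx x := by
        by_contra hne
        exact hx (Pi.single_eq_of_ne hne _)
      subst hk
      rw [Pi.single_eq_same] at hx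
      refine Finset.mem_image.2 ⟨x, Finset.mem_product.2 ⟨?_, ?_⟩, rfl⟩
      · simpa [hS] using left_ne_zero_of_mul hx
      · simpa [hS] using right_ne_zero_of_mul hx
    refine (Finset.card_le_card hsub).trans (Finset.card_image_le.trans ?_)
    rw [Finset.card_product, ← sq]
    rfl

/-! ### Dimension and duality -/

theorem algebraMap_natCast_of_odd (hn : Odd n) : (n : K) = 1 := by
  have := charP_two_of_algebra K
  obtain ⟨m, rfl⟩ := hn
  push_cast
  rw [CharTwo.two_eq_zero, zero_mul, zero_add]

/-- Parseval's identity. -/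
theorem sum_dft_mul_dft [NeZero n] {χ : AddChar (ZMod n) K} (hχ : χ.IsPrimitive) (hn : Odd n)
    (c d : Fin n → ZMod 2) :
    ∑ t, dft χ c t * dft χ d (-t) = algebraMap (ZMod 2) K (c ⬝ᵥ d) := by
  have hcast : ∀ i j : Fin n, ((i : ℕ) : ZMod n) - (j : ℕ) = 0 ↔ i = j := by
    intro i j
    rw [sub_eq_zero, ZMod.natCast_eq_natCast_iff', Nat.mod_eq_of_lt i.2, Nat.mod_eq_of_lt j.2,
      Fin.ext_iff]
  have h1 : ∀ t, dft χ c t * dft χ d (-t) = ∑ i, ∑ j, algebraMap (ZMod 2) K (c i * d j) *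
      χ (t * ((i : ℕ) - (j : ℕ))) := by
    intro t
    rw [dft_apply, dft_apply, Finset.sum_mul_sum]
    refine Finset.sum_congr rfl fun i _ => Finset.sum_congr rfl fun j _ => ?_
    rw [map_mul (algebraMap (ZMod 2) K), mul_mul_mul_comm, ← AddChar.map_add_eq_mul]
    congr 2
    ring
  simp only [h1]
  rw [Finset.sum_comm, dotProduct, map_sum]
  refine Finset.sum_congr rfl fun i _ => ?_
  rw [Finset.sum_comm]
  -- Orthogonality of characters leaves the diagonal `i = j` with a factor `n`, which is `1` in `K`.
  simp only [← Finset.mul_sum, AddChar.sum_mulShift _ hχ, hcast, ZMod.card]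
  rw [Finset.sum_eq_single i]
  · rw [if_pos rfl, algebraMap_natCast_of_odd hn, mul_one]
  · intro j _ hj
    rw [if_neg hj.symm, Nat.cast_zero, mul_zero]
  · simp

theorem spectralCode_neg_compl_le_dualCode [NeZero n] {χ : AddChar (ZMod n) K}
    (hχ : χ.IsPrimitive) (hn : Odd n) (A : Set (ZMod n)) :
    spectralCode χ (-Aᶜ) ≤ dualCode (spectralCode χ A) := by
  intro d hd c hc
  apply (algebraMap (ZMod 2) K).injective
  rw [dotProduct_comm, ← sum_dft_mul_dft hχ hn, map_zero]
  refine Finset.sum_eq_zero fun t _ => ?_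
  by_cases ht : t ∈ A
  · rw [hc t ht, zero_mul]
  · rw [hd (-t) (by simpa using ht), mul_zero]

theorem wordPoly_eq_degreeLTEquiv_symm (c : Fin n → ZMod 2) :
    wordPoly c = ((Polynomial.degreeLTEquiv (ZMod 2) n).symm c : Polynomial (ZMod 2)) :=
  Finset.sum_congr rfl fun _ _ => Polynomial.C_mul_X_pow_eq_monomial

theorem two_mul_bijective (hn : Odd n) : Function.Bijective fun t : ZMod n => 2 * t :=
  (ZMod.unitOfCoprime 2 (Nat.coprime_two_left.2 hn)).mulLeft_bijective

open Polynomial in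
-- Doubling permutes `A`, so Frobenius fixes the product. Its coefficients satisfy `a² = a` and are
-- therefore `0` or `1`.
theorem exists_map_eq_prod_X_sub_C (χ : AddChar (ZMod n) K) (hn : Odd n)
    {A : Finset (ZMod n)} (hA : ∀ t ∈ A, 2 * t ∈ A) :
    ∃ g : (ZMod 2)[X], g.map (algebraMap (ZMod 2) K) = ∏ t ∈ A, (X - C (χ t)) := by
  have := charP_two_of_algebra K
  rw [← mem_lifts, lifts_iff_coeff_lifts]
  have hfrob : (∏ t ∈ A, (X - C (χ t))).map (frobenius K 2) = ∏ t ∈ A, (X - C (χ t)) := by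
    rw [Polynomial.map_prod]
    have hinj := (two_mul_bijective hn).injective
    have himage : A.image (fun t => 2 * t) = A := by
      refine Finset.eq_of_subset_of_card_le ?_ (Finset.card_image_of_injective A hinj).ge
      intro t ht
      obtain ⟨s, hs, rfl⟩ := Finset.mem_image.1 ht
      exact hA s hs
    conv_rhs => rw [← himage, Finset.prod_image fun _ _ _ _ h => hinj h]
    refine Finset.prod_congr rfl fun t _ => ?_
    rw [Polynomial.map_sub, map_X, map_C, frobenius_def, ← AddChar.map_nsmul_eq_pow]
    simp
  intro k
  have h1 := congrArg (fun p => coeff p k) hfrob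
  simp only [coeff_map, frobenius_def] at h1
  rw [sq] at h1
  rcases IsIdempotentElem.iff_eq_zero_or_one.1 h1 with h | h
  · exact ⟨0, by rw [map_zero, h]⟩
  · exact ⟨1, by rw [map_one, h]⟩

open Polynomial in
theorem aeval_wordPoly (χ : AddChar (ZMod n) K) (c : Fin n → ZMod 2) (t : ZMod n) :
    aeval (χ t) (wordPoly c) = dft χ c t := by
  rw [wordPoly, map_sum, dft_apply]
  refine Finset.sum_congr rfl fun i _ => ?_
  rw [map_mul, aeval_C, map_pow, aeval_X, ← AddChar.map_nsmul_eq_pow, nsmul_eq_mul]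

open Polynomial in
-- The multiples of degree below `n` of the polynomial with roots `χ t`, `t ∈ A`, already give this
-- many dimensions. Equality follows later from duality.
theorem le_finrank_spectralCode [NeZero n] (χ : AddChar (ZMod n) K) (hn : Odd n)
    {A : Set (ZMod n)} (hA : ∀ t ∈ A, 2 * t ∈ A) :
    n - A.ncard ≤ Module.finrank (ZMod 2) (spectralCode χ A) := by
  classical
  obtain ⟨g, hg⟩ := exists_map_eq_prod_X_sub_C χ hn (A := A.toFinset) (by simpa using hA)
  have hmonic : g.Monic := by
    have : (g.map (algebraMap (ZMod 2) K)).Monic :=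
      hg ▸ monic_prod_of_monic _ _ fun t _ => monic_X_sub_C _
    exact Polynomial.monic_of_injective (algebraMap (ZMod 2) K).injective this
  have hdeg : g.degree = (A.ncard : ℕ) := by
    rw [← degree_map g (algebraMap (ZMod 2) K), hg, degree_prod]
    simp [Set.ncard_eq_toFinset_card']
  have hle : A.ncard ≤ n := by
    simpa [Nat.card_zmod] using Set.ncard_le_card A
  have hmem : ∀ p : degreeLT (ZMod 2) (n - A.ncard), (g * p : (ZMod 2)[X]) ∈
      degreeLT (ZMod 2) n := by
    intro p
    have hp := mem_degreeLT.1 p.2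
    rw [mem_degreeLT]
    by_cases h0 : (p : (ZMod 2)[X]) = 0
    · rw [h0, mul_zero, degree_zero]
      exact WithBot.bot_lt_coe n
    · rw [degree_mul, hdeg, degree_eq_natDegree h0]
      rw [degree_eq_natDegree h0, Nat.cast_lt] at hp
      norm_cast
      lia
  let f : degreeLT (ZMod 2) (n - A.ncard) →ₗ[ZMod 2] (Fin n → ZMod 2) :=
    (degreeLTEquiv (ZMod 2) n).toLinearMap ∘ₗ
      ((LinearMap.mulLeft (ZMod 2) g).domRestrict _).codRestrict _ hmem
  have hf : ∀ p, wordPoly (f p) = g * p := fun p => by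
    rw [wordPoly_eq_degreeLTEquiv_symm]
    change (((degreeLTEquiv (ZMod 2) n).symm (degreeLTEquiv (ZMod 2) n ⟨_, hmem p⟩) :
      degreeLT (ZMod 2) n) : (ZMod 2)[X]) = _
    rw [LinearEquiv.symm_apply_apply]
  have hinj : Function.Injective f := by
    intro p q hpq
    have h1 : g * (p : (ZMod 2)[X]) = g * q := by rw [← hf, ← hf, hpq]
    exact Subtype.ext (mul_left_cancel₀ hmonic.ne_zero h1)
  have hrange : LinearMap.range f ≤ spectralCode χ A := by
    rintro _ ⟨p, rfl⟩ t ht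
    have hroot : aeval (χ t) g = 0 := by
      rw [← eval_map_algebraMap, hg, eval_prod]
      exact Finset.prod_eq_zero (Set.mem_toFinset.2 ht) (by simp)
    rw [← aeval_wordPoly, hf, map_mul, hroot, zero_mul]
  calc n - A.ncard = Module.finrank (ZMod 2) (LinearMap.range f) := by
        rw [LinearMap.finrank_range_of_inj hinj, (degreeLTEquiv (ZMod 2) _).finrank_eq,
          Module.finrank_fin_fun]
    _ ≤ _ := Submodule.finrank_mono hrange

/-- The lower bounds for the codes of `A` and `-Aᶜ` add up to `n`. As the second code lies in the
dual of the first, both bounds and the inclusion are equalities. -/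
theorem dualCode_spectralCode [NeZero n] {χ : AddChar (ZMod n) K} (hχ : χ.IsPrimitive)
    (hn : Odd n) {A : Set (ZMod n)} (hA : ∀ t ∈ A, 2 * t ∈ A) (hA' : ∀ t ∈ Aᶜ, 2 * t ∈ Aᶜ) :
    dualCode (spectralCode χ A) = spectralCode χ (-Aᶜ) ∧
      Module.finrank (ZMod 2) (spectralCode χ A) = n - A.ncard := by
  have h1 := le_finrank_spectralCode χ hn hA
  have h2 := le_finrank_spectralCode χ hn (A := -Aᶜ) fun t ht => by
    have := hA' (-t) ht
    rwa [mul_neg] at this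
  have h3 := spectralCode_neg_compl_le_dualCode hχ hn A
  have h4 := Submodule.finrank_mono h3
  have h5 : A.ncard + (Aᶜ).ncard = n := by
    rw [Set.ncard_add_ncard_compl, Nat.card_zmod]
  have h6 : (-Aᶜ).ncard = (Aᶜ).ncard := by
    rw [← Set.image_neg_eq_neg, Set.ncard_image_of_injective _ neg_injective]
  rw [finrank_dualCode] at h4
  refine ⟨(Submodule.eq_of_le_of_finrank_le h3 ?_).symm, ?_⟩
  · rw [finrank_dualCode]
    lia
  · have := Submodule.finrank_le (spectralCode χ A)
    rw [Module.finrank_fin_fun] at this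
    lia

/-! ### Cyclic codes with a given defining set -/

open Polynomial in
-- For odd `n`, `x^n - 1` is separable, so `g` has simple roots, all of them powers `α^t` with `t ∈
-- A`. A word polynomial vanishing at all of these is divisible by `g`.
theorem spectralCode_le_of_hasDefiningSet [NeZero n] {α : K} (hα : IsPrimitiveRoot α n)
    (hn : Odd n) {C : BinaryCode n} {A : Set (ZMod n)} (hC : HasDefiningSet α C A) :
    spectralCode (AddChar.zmodChar n hα.pow_eq_one) A ≤ C := by
  obtain ⟨-, g, hg, rfl⟩ := hC
  intro c hc
  rw [hg.mem_iff, ← map_dvd_map' (algebraMap (ZMod 2) K)]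
  have hdvd : g.map (algebraMap (ZMod 2) K) ∣ X ^ n - 1 := by
    simpa using Polynomial.map_dvd (algebraMap (ZMod 2) K) hg.dvd
  have hne : (X ^ n - 1 : K[X]) ≠ 0 := X_pow_sub_C_ne_zero (NeZero.pos n) 1
  have hsplits : (g.map (algebraMap (ZMod 2) K)).Splits :=
    (X_pow_sub_one_splits hα).of_dvd hne hdvd
  have hsep : (g.map (algebraMap (ZMod 2) K)).Separable := by
    refine Separable.of_dvd (X_pow_sub_one_separable_iff.2 ?_) hdvd
    rw [algebraMap_natCast_of_odd hn]
    exact one_ne_zero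
  -- `roots` of the zero polynomial is empty by convention, so the comparison of roots needs this
  -- case removed.
  by_cases hw : (wordPoly c).map (algebraMap (ZMod 2) K) = 0
  · rw [hw]
    exact dvd_zero _
  refine hsplits.dvd_of_roots_le_roots (hg.monic.map _).ne_zero
    ((Multiset.le_iff_subset (nodup_roots hsep)).2 fun x hx => ?_)
  have hx' : aeval x g = 0 := by simpa using (mem_roots'.1 hx).2
  have hxn : x ^ n = 1 := by
    have h := (mem_roots'.1 hx).2.dvd hdvd
    simpa [sub_eq_zero] using h
  obtain ⟨i, hi, rfl⟩ := hα.eq_pow_of_pow_eq_one hxn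
  have hval : (i : ZMod n).val = i := ZMod.val_cast_of_lt hi
  have h := hc (i : ZMod n) (by rw [Set.mem_ofPred_eq, hval, hx'])
  rw [← aeval_wordPoly, AddChar.zmodChar_apply, hval] at h
  rw [mem_roots hw, IsRoot.def, eval_map_algebraMap, h]

theorem minDist_le_hammingNorm {C : BinaryCode n} {c : Fin n → ZMod 2} (hc : c ∈ C)
    (h0 : c ≠ 0) : minDist C ≤ hammingNorm c :=
  Nat.sInf_le ⟨c, hc, h0, rfl⟩

/-- The square root bound. -/
theorem minDist_le_hammingNorm_sq [NeZero n] {b : ℤ} {X S₁ S₂ : Set (ZMod n)}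
    (hS : IsSplitting n b X S₁ S₂) (χ : AddChar (ZMod n) K) {C : BinaryCode n}
    (hC : spectralCode χ Xᶜ ≤ C) {c : Fin n → ZMod 2} (a : ZMod n)
    (hc : ∀ t ∈ S₁, dft χ c (a * t) = 0) {s : ZMod n} (hs : s ∈ X)
    (hcs : dft χ c (a * s) ≠ 0) : minDist C ≤ hammingNorm c ^ 2 := by
  -- The dilation `a` is `1` for words of `C₁` and `-1` for words of `C₂^⊥`, whose zeros lie on
  -- `-S₂`.
  obtain ⟨w, hw, hwt⟩ := exists_dft_eq_mul χ c a (a * b)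
  refine (minDist_le_hammingNorm (hC fun t ht => ?_) ?_).trans hwt
  · rw [hw]
    rcases hS.mem_cases t with h | h | h
    · exact absurd h ht
    · rw [hc t h, zero_mul]
    · rw [mul_assoc a, hc _ (hS.symm.mul_mem_of_mem h), mul_zero]
  · rintro rfl
    obtain ⟨j, hj⟩ := hS.exists_mul_eq hs
    have h := hw s
    rw [map_zero, Pi.zero_apply, mul_assoc a, hj, mul_left_comm] at h
    exact mul_ne_zero hcs (dft_two_pow_mul_ne_zero hcs j) h.symm

end Fourier

end QuantumDuadic

theorem mainTheorem3 (n : ℕ) (b : ℤ) (hn : Odd n) (hb_pos : 0 < b) (hb : Odd b)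
    (hnb : Int.gcd (n : ℤ) b = 1) (S₁ S₂ : Set (ZMod n))
    (hS : QuantumDuadic.IsSplitting n b (QuantumDuadic.fixSet n b) S₁ S₂)
    {K : Type*} [Field K] [Algebra (ZMod 2) K] (α : K) (hα : IsPrimitiveRoot α n)
    (C : QuantumDuadic.BinaryCode n)
    (hC : QuantumDuadic.HasDefiningSet α C (QuantumDuadic.fixSet n b)ᶜ) :
    ∃ (Q : Submodule ℂ (QuantumDuadic.Qubits n)) (d : ℕ),
      QuantumDuadic.IsCSSCode Q ∧
      QuantumDuadic.IsQuantumCode Q (QuantumDuadic.fixSet n b).ncard d ∧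
      Real.sqrt (QuantumDuadic.minDist C : ℝ) ≤ (d : ℝ) := by
  
  have : NeZero n := ⟨hn.pos.ne'⟩
  set X := QuantumDuadic.fixSet n b
  set χ := AddChar.zmodChar n hα.pow_eq_one
  have hχ : χ.IsPrimitive := AddChar.zmodChar_primitive_of_primitive_root n hα
  have hCX := QuantumDuadic.spectralCode_le_of_hasDefiningSet hα hn hC
  have hc₁ : S₁ᶜ = S₂ ∪ X := hS.compl_S₁
  have hc₂ : (S₁ ∪ X)ᶜ = S₂ := by rw [← hS.symm.compl_S₁, compl_compl]
  have hX : ∀ t ∈ X, 2 * t ∈ X := fun t => hS.cosets_X.two_mul_mem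
  have hS₁ : ∀ t ∈ S₁, 2 * t ∈ S₁ := fun t => hS.cosets_S₁.two_mul_mem
  have hS₂ : ∀ t ∈ S₂, 2 * t ∈ S₂ := fun t => hS.cosets_S₂.two_mul_mem
  obtain ⟨hdual₁, hdim₁⟩ := QuantumDuadic.dualCode_spectralCode hχ hn hS₁
    (hc₁ ▸ fun t ht => ht.imp (hS₂ t) (hX t))
  obtain ⟨hdual₂, hdim₂⟩ := QuantumDuadic.dualCode_spectralCode hχ hn (A := S₁ ∪ X)
    (fun t ht => ht.imp (hS₁ t) (hX t)) (hc₂.symm ▸ hS₂)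
  rw [hc₁] at hdual₁
  rw [hc₂] at hdual₂
  have hcard : (S₁ ∪ X).ncard = S₁.ncard + X.ncard :=
    Set.ncard_union_eq hS.disjoint_X_S₁.symm
  have hcard_le : (S₁ ∪ X).ncard ≤ n := by
    simpa [Nat.card_zmod] using Set.ncard_le_card (S₁ ∪ X)
  have hX_pos : 0 < X.ncard := (Set.ncard_pos).2 hS.nonempty_X
  set C₁ := QuantumDuadic.spectralCode χ S₁
  set C₂ := QuantumDuadic.spectralCode χ (S₁ ∪ X)
  have hlt : C₂ < C₁ := by
    refine lt_of_le_of_ne (fun c hc t ht => hc t (Or.inl ht)) fun h => ?_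
    rw [h] at hdim₂
    lia
  obtain ⟨d, hQ, hd⟩ := QuantumDuadic.exists_isQuantumCode_cssSpace hlt
    -- An upward closed predicate carries the squared bound directly; the root is taken only at the
    -- end.
    (D := fun w => QuantumDuadic.minDist C ≤ w ^ 2)
    (fun w w' hw h => le_trans h (Nat.pow_le_pow_left hw 2))
    (fun u hu₁ hu₂ => by
      rw [QuantumDuadic.mem_spectralCode] at hu₂
      push Not at hu₂
      obtain ⟨s, hs, hus⟩ := hu₂
      refine QuantumDuadic.minDist_le_hammingNorm_sq hS χ hCX 1
        (fun t ht => by rw [one_mul, hu₁ t ht])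
        (hs.resolve_left fun h => hus (hu₁ s h)) (by rwa [one_mul]))
    -- Here `s ∈ -(S₂ ∪ X)` and the transform of `v` vanishes on `-S₂`, so `-s ∈ X`, and the swapped
    -- splitting applies with dilation `-1`.
    (fun v hv₂ hv₁ => by
      rw [hdual₂] at hv₂
      rw [hdual₁, QuantumDuadic.mem_spectralCode] at hv₁
      push Not at hv₁
      obtain ⟨s, hs, hvs⟩ := hv₁
      refine QuantumDuadic.minDist_le_hammingNorm_sq hS.symm χ hCX (-1)
        (fun t ht => by rw [neg_one_mul, hv₂ _ (Set.neg_mem_neg.2 ht)])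
        (s := -s) (hs.resolve_left fun h => hvs (hv₂ s h)) (by rwa [neg_one_mul, neg_neg]))
  have hk : Module.finrank (ZMod 2) C₁ - Module.finrank (ZMod 2) C₂ = X.ncard := by
    rw [hdim₁, hdim₂]
    lia
  refine ⟨_, d, ⟨C₁, C₂, hlt.le, rfl⟩, hk ▸ hQ, ?_⟩
  rw [Real.sqrt_le_left (Nat.cast_nonneg d)]
  exact_mod_cast hd
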